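/- Theorem (minimal model checking for positive HEF theories). A clause $H \leftarrow B$ is a pair of finite sets of atoms, and a CNF theory $\Pi$ is a finite set of clauses; $\mathrm{atoms}(\Pi)$ is the set of atoms occurring in $\Pi$, and $\Pi$ is positive if no clause of $\Pi$ has an empty head. A model of $\Pi$ is a set $M \subseteq \mathrm{atoms}(\Pi)$ such that, for every clause $H \leftarrow B$ of $\Pi$, $H \cap M \neq \emptyset$ or $B \not\subseteq M$; it is minimal if no proper subset of $M$ is a model of $\Pi$. For $Z \subseteq Y \subseteq \mathrm{atoms}(\Pi)$, $Z$ is outbound in $Y$ for $\Pi$ if some clause $H \leftarrow B$ of $\Pi$ satisfies $H \cap Z \neq \emptyset$, $B \cap (Y \setminus Z) \neq \emptyset$, $B \cap Z = \emptyset$ and $H \cap (Y \setminus Z) = \emptyset$. A non-empty $Y \subseteq \mathrm{atoms}(\Pi)$ is elementary for $\Pi$ if every non-empty proper subset of $Y$ is outbound in $Y$ for $\Pi$. The theory $\Pi$ is head-elementary-set-free (HEF) if there are no clause $H \leftarrow B$ of $\Pi$ and no elementary set $E$ for $\Pi$ with $|E \cap H| > 1$. Claim: there is a deterministic Turing machine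 that, on every input consisting of a CNF theory $\Pi$ and a finite set $N$ of atoms (theory and set written as lists, with atoms named by natural numbers in binary), halts with answer yes or no in time polynomial in the length of the input, and such that whenever $\Pi$ is positive and HEF and $N \subseteq \mathrm{atoms}(\Pi)$, the answer is yes if and only if $N$ is a minimal model of $\Pi$. -/

import Mathlib

/-! Propositional CNF theories in implication form, head-elementary-set-free theories, minimal
models, and an encoding of inputs as strings for Turing machines. -/

namespace CNF

/-- A clause `H ← B`, with head `H` and body `B` finite sets of atoms: the disjunction of the
atoms of `H` holds whenever all atoms of `B` hold. -/
structure Clause (α : Type) where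
  head : Finset α
  body : Finset α
deriving DecidableEq

/-- A CNF theory: a finite set of clauses. -/
abbrev Theory (α : Type) : Type := Finset (Clause α)

section

variable {α : Type} [DecidableEq α]

/-- The atoms occurring in a theory. -/
def atoms (T : Theory α) : Finset α := T.biUnion fun c => c.head ∪ c.body

/-- A theory is positive if it contains no constraint, i.e. no clause with an empty head. -/
def IsPositive (T : Theory α) : Prop := ∀ c ∈ T, c.head.Nonempty

/-- A clause is true in `M` if some head atom is in `M` or some body atom is not in `M`. -/
def Clause.IsTrue (c : Clause α) (M : Finset α) : Prop :=
  (∃ a ∈ c.head, a ∈ M) ∨ (∃ b ∈ c.body, b ∉ M)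

/-- A model of `T`: a set of atoms of `T` in which every clause of `T` is true. -/
def IsModel (T : Theory α) (M : Finset α) : Prop :=
  M ⊆ atoms T ∧ ∀ c ∈ T, c.IsTrue M

/-- A minimal model: a model no proper subset of which is a model. -/
def IsMinimalModel (T : Theory α) (M : Finset α) : Prop :=
  IsModel T M ∧ ∀ M' : Finset α, M' ⊂ M → ¬ IsModel T M'

/-- `Z` is outbound in `Y` for `T` (used for `Z ⊆ Y ⊆ atoms T`). -/
def IsOutbound (T : Theory α) (Y Z : Finset α) : Prop :=
  ∃ c ∈ T, (c.head ∩ Z).Nonempty ∧ (c.body ∩ (Y \ Z)).Nonempty ∧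
    c.body ∩ Z = ∅ ∧ c.head ∩ (Y \ Z) = ∅

/-- `Y` is elementary for `T`: a nonempty set of atoms of `T`, all of whose nonempty proper subsets
are outbound in `Y`. -/
def IsElementary (T : Theory α) (Y : Finset α) : Prop :=
  Y.Nonempty ∧ Y ⊆ atoms T ∧
    ∀ Z : Finset α, Z.Nonempty → Z ⊂ Y → IsOutbound T Y Z

/-- Head-elementary-set-free theories: no elementary set contains two or more atoms of one
clause head. -/
def IsHEF (T : Theory α) : Prop :=
  ∀ c ∈ T, ¬ ∃ E : Finset α, IsElementary T E ∧ 1 < (E ∩ c.head).card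

end

/-- A written input of the minimal model checking problem, with natural numbers as names of
atoms: a list of clauses, each given by the list of its head atoms and the list of its body atoms,
and a list of the atoms of the candidate set. Order is arbitrary and repetitions are allowed. -/
structure Input where
  clauses : List (List ℕ × List ℕ)
  candidate : List ℕ

/-- The theory written down in an input. -/
def Input.theory (I : Input) : Theory ℕ :=
  (I.clauses.map fun p => (⟨p.1.toFinset, p.2.toFinset⟩ : Clause ℕ)).toFinset

/-- The candidate set of atoms written down in an input. -/
def Input.set (I : Input) : Finset ℕ := I.candidate.toFinset

/-- Every theory and every set of atoms can be written down as an input. -/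
theorem Input.exists_eq (T : Theory ℕ) (N : Finset ℕ) :
    ∃ I : Input, I.theory = T ∧ I.set = N := by
  refine ⟨⟨T.toList.map fun c => (c.head.toList, c.body.toList), N.toList⟩, ?_, ?_⟩
  · ext c
    simp [Input.theory]
  · simp [Input.set]

/-- The finite alphabet in which inputs are written. -/
inductive Symbol
  | bit (b : Bool)
  | comma
  | arrow
  | period
  | bar
deriving DecidableEq, Fintype

/-- An atom is written as its binary expansion followed by a comma. -/
def encodeAtom (a : ℕ) : List Symbol :=
  (Computability.encodeNat a).map Symbol.bit ++ [Symbol.comma]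

/-- A list of atoms is written atom by atom. -/
def encodeAtoms (l : List ℕ) : List Symbol := l.flatMap encodeAtom

/-- A clause is written as its head atoms, an arrow, its body atoms, and a period. -/
def encodeClause (p : List ℕ × List ℕ) : List Symbol :=
  encodeAtoms p.1 ++ [Symbol.arrow] ++ encodeAtoms p.2 ++ [Symbol.period]

/-- An input is written as its clauses, a bar, and the atoms of the candidate set. -/
def Input.encode (I : Input) : List Symbol :=
  I.clauses.flatMap encodeClause ++ [Symbol.bar] ++ encodeAtoms I.candidate

end CNF

/-! Call an atom `x` of `N` derivable from `D ⊆ N` if some clause has its body in `D` and `x` as its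
only head atom in `N`. Starting from the empty set, derivation can only add atoms that belong to
every `M ⊆ N` satisfying all clauses. Hence if `N` satisfies the clauses and is exhausted by
derivation, it is a minimal model.

The converse rests on the HEF property (`IsMinimalModel.subset_of_closed`). Suppose `N` is a minimal
model and derivation stops at some `D` not containing `N`. Then `N \ D` is unfounded: every clause
with body in `N` whose only head atom in `N` lies in this set also has a body atom in it. A minimal
nonempty unfounded `Y ⊆ N` is elementary, because a clause showing that a proper subset `Z` is not
unfounded shows that `Z` is outbound in `Y`. By HEF no head meets `Y` twice, so a clause true in `N`
and false in `N \ Y` would have exactly one head atom in `N`, lying in `Y`, and body in `N \ Y`,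
against unfoundedness. Thus `N \ Y` is a smaller model, a contradiction.

So minimality amounts to a closure computation plus a truth check (`isMinimalModel_iff`). Its
running time is established in a small language of stack programs, whose timed executions are
simulated step for step by a multi-stack Turing machine (`Exec.steps`, `tm2ComputableInPolyTime`).
The program stores the status of each atom as a tag behind every written occurrence, so that testing
derivability and checking truth are runs of finite automata over the written clauses. It runs in
cubic time on every input (`exec_checkProg`). -/

/-- Programs operating on stacks of symbols from `Γ`, indexed by `K`. -/
inductive StackProg (K Γ : Type) : Type
  | skip : StackProg K Γ
  | push (k : K) (a : Γ) : StackProg K Γ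
  | seq (p q : StackProg K Γ) : StackProg K Γ
  /-- Pop a stack and continue according to the popped symbol, if any. -/
  | case (k : K) (f : Option Γ → StackProg K Γ) : StackProg K Γ
  /-- Pop a stack, run the program selected by the popped symbol, and repeat until the stack is
  found empty. -/
  | loop (k : K) (f : Γ → StackProg K Γ) : StackProg K Γ

namespace StackProg

open Function Turing

/-! ### Timed semantics of stack programs. -/

section Semantics

variable {K Γ : Type} [DecidableEq K]

/-- `Exec p S S' t`: started on the stacks `S`, the program `p` ends with the stacks `S'` after at
most `t` steps. -/
inductive Exec : StackProg K Γ → (K → List Γ) → (K → List Γ) → ℕ → Prop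
  | skip (S : K → List Γ) : Exec skip S S 1
  | push (k : K) (a : Γ) (S : K → List Γ) : Exec (push k a) S (update S k (a :: S k)) 1
  | seq {p q : StackProg K Γ} {S S₁ S₂ : K → List Γ} {t₁ t₂ : ℕ} :
      Exec p S S₁ t₁ → Exec q S₁ S₂ t₂ → Exec (seq p q) S S₂ (t₁ + t₂)
  | case {k : K} {f : Option Γ → StackProg K Γ} {S S' : K → List Γ} {t : ℕ} :
      Exec (f (S k).head?) (update S k (S k).tail) S' t → Exec (case k f) S S' (t + 1)
  | loop_nil {k : K} {f : Γ → StackProg K Γ} {S : K → List Γ} :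
      S k = [] → Exec (loop k f) S S 1
  | loop_cons {k : K} {f : Γ → StackProg K Γ} {S S₁ S₂ : K → List Γ} {a : Γ} {l : List Γ}
      {t₁ t₂ : ℕ} : S k = a :: l → Exec (f a) (update S k l) S₁ t₁ →
      Exec (loop k f) S₁ S₂ t₂ → Exec (loop k f) S S₂ (t₁ + t₂ + 1)
  | mono {p : StackProg K Γ} {S S' : K → List Γ} {t t' : ℕ} :
      Exec p S S' t → t ≤ t' → Exec p S S' t'

end Semantics

/-! ### Translation of stack programs into Turing machines. -/

section Compilation

variable {K Γ : Type}

/-- The labels of the machine code of a program. -/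
def Label : StackProg K Γ → Type
  | skip => Unit
  | push _ _ => Unit
  | seq p q => p.Label ⊕ q.Label
  | case _ f => Option (Σ o, (f o).Label)
  | loop _ f => Option (Σ a, (f a).Label)

noncomputable instance Label.fintype [Fintype Γ] : ∀ p : StackProg K Γ, Fintype p.Label
  | skip => inferInstanceAs (Fintype Unit)
  | push _ _ => inferInstanceAs (Fintype Unit)
  | seq p q =>
    letI := Label.fintype p
    letI := Label.fintype q
    inferInstanceAs (Fintype (p.Label ⊕ q.Label))
  | case _ f =>
    letI := fun o => Label.fintype (f o)
    inferInstanceAs (Fintype (Option (Σ o, (f o).Label)))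
  | loop _ f =>
    letI := fun a => Label.fintype (f a)
    inferInstanceAs (Fintype (Option (Σ a, (f a).Label)))

/-- The entry point of the machine code of a program. -/
def start : ∀ p : StackProg K Γ, p.Label
  | skip => ()
  | push _ _ => ()
  | seq p _ => Sum.inl p.start
  | case _ _ => (none : Option _)
  | loop _ _ => (none : Option _)

/-- The stacks of the machine: an input stack, an output stack, and the stacks of the program. -/
inductive MachineStack (K : Type)
  | input
  | output
  | work (k : K)
deriving DecidableEq, Fintype

/-- The alphabets of the stacks of the machine. -/
abbrev Alphabet (A Γ : Type) : MachineStack K → Type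
  | .input => A
  | .output => Bool
  | .work _ => Γ

/-- The stack contents of the machine. -/
def contents {A : Type} (i : List A) (o : List Bool) (S : K → List Γ) :
    ∀ k : MachineStack K, List (Alphabet A Γ k)
  | .input => i
  | .output => o
  | .work k => S k

/-- The machine code of a program whose labels are embedded in `Λ`, and which jumps to `exit` at
the end. -/
def code (A : Type) {Λ : Type} : ∀ p : StackProg K Γ, (p.Label → Λ) → Λ → p.Label →
    TM2.Stmt (Alphabet (K := K) A Γ) Λ (Option Γ)
  | skip, _, exit, _ => .goto fun _ => exit
  | push k a, _, exit, _ => .push (.work k) (fun _ => a) (.goto fun _ => exit)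
  | seq p q, emb, exit, l =>
    match l with
    | Sum.inl l => p.code A (fun l => emb (Sum.inl l)) (emb (Sum.inr q.start)) l
    | Sum.inr l => q.code A (fun l => emb (Sum.inr l)) exit l
  | case k f, emb, exit, l =>
    match l with
    | none => .pop (.work k) (fun _ o => o) (.goto fun o => emb (some ⟨o, (f o).start⟩))
    | some ⟨o, l⟩ => (f o).code A (fun l => emb (some ⟨o, l⟩)) exit l
  | loop k f, emb, exit, l =>
    match l with
    | none => .pop (.work k) (fun _ o => o) (.goto fun o =>
        o.elim exit fun a => emb (some ⟨a, (f a).start⟩))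
    | some ⟨a, l⟩ => (f a).code A (fun l => emb (some ⟨a, l⟩)) (emb none) l

variable [DecidableEq K] {A : Type}

theorem update_contents_work (i : List A) (o : List Bool) (S : K → List Γ) (k : K) (l : List Γ) :
    update (contents i o S) (.work k) l = contents i o (update S k l) := by
  funext j
  rcases j with _ | _ | j
  · exact update_of_ne (by simp) _ _
  · exact update_of_ne (by simp) _ _
  · by_cases h : j = k
    · subst h
      exact (update_self _ _ _).trans (update_self j l S).symm
    · exact (update_of_ne (by simpa using h) _ _).trans
        (show S j = update S k l j from (update_of_ne h l S).symm)

theorem update_contents_input (i i' : List A) (o : List Bool) (S : K → List Γ) :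
    update (contents i o S) .input i' = contents i' o S := by
  funext j
  rcases j with _ | _ | j
  · exact update_self _ _ _
  · exact update_of_ne (by simp) _ _
  · exact update_of_ne (by simp) _ _

theorem update_contents_output (i : List A) (o o' : List Bool) (S : K → List Γ) :
    update (contents i o S) .output o' = contents i o' S := by
  funext j
  rcases j with _ | _ | j
  · exact update_of_ne (by simp) _ _
  · exact update_self _ _ _
  · exact update_of_ne (by simp) _ _

/-- `Steps M c c' t`: the machine gets from `c` to `c'` in at most `t` steps. -/
def Steps {Λ σ : Type} {G : MachineStack K → Type} (M : Λ → TM2.Stmt G Λ σ)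
    (c c' : TM2.Cfg G Λ σ) (t : ℕ) : Prop :=
  ∃ n ≤ t, (flip bind (TM2.step M))^[n] (some c) = some c'

section Steps

variable {Λ σ : Type} {G : MachineStack K → Type} {M : Λ → TM2.Stmt G Λ σ}
  {c c₁ c₂ : TM2.Cfg G Λ σ} {t t₁ t₂ : ℕ}

theorem Steps.of_stepAux {l : Λ} {v : σ} {S : ∀ k, List (G k)} {q : TM2.Stmt G Λ σ} (h : M l = q)
    (hq : TM2.stepAux q v S = c) : Steps M ⟨some l, v, S⟩ c 1 :=
  ⟨1, le_rfl, congrArg some ((congrArg (fun q => TM2.stepAux q v S) h).trans hq)⟩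

theorem Steps.trans (h₁ : Steps M c c₁ t₁) (h₂ : Steps M c₁ c₂ t₂) : Steps M c c₂ (t₁ + t₂) := by
  obtain ⟨n₁, hn₁, e₁⟩ := h₁
  obtain ⟨n₂, hn₂, e₂⟩ := h₂
  exact ⟨n₂ + n₁, by omega, by rw [iterate_add_apply, e₁, e₂]⟩

theorem Steps.mono (h : Steps M c c₁ t₁) (ht : t₁ ≤ t₂) : Steps M c c₁ t₂ := by
  obtain ⟨n, hn, e⟩ := h
  exact ⟨n, hn.trans ht, e⟩

end Steps

/-- The machine code of a program performs its executions. -/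
theorem Exec.steps {p : StackProg K Γ} {S S' : K → List Γ} {t : ℕ} (h : Exec p S S' t) {Λ : Type}
    {M : Λ → TM2.Stmt (Alphabet (K := K) A Γ) Λ (Option Γ)} (i : List A) (o : List Bool) :
    ∀ (emb : p.Label → Λ) (exit : Λ) (v : Option Γ),
      (∀ l, M (emb l) = p.code A emb exit l) →
      ∃ v', Steps M ⟨some (emb p.start), v, contents i o S⟩ ⟨some exit, v', contents i o S'⟩ t := by
  -- `emb` and `exit` must vary in the induction: the first half of a `seq` exits to the start of
  -- the second, and a loop body exits to the loop head. No invariant on the register `v` is needed,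
  -- since it is read only directly after a pop.
  induction h with
  | skip S =>
    intro emb exit v hM
    exact ⟨v, Steps.of_stepAux (hM _) rfl⟩
  | push k a S =>
    intro emb exit v hM
    exact ⟨v, Steps.of_stepAux (hM _)
      (congrArg (TM2.Cfg.mk (some exit) v) (update_contents_work i o S k (a :: S k)))⟩
  | @seq p q S S₁ S₂ t₁ t₂ _ _ ih₁ ih₂ =>
    intro emb exit v hM
    obtain ⟨v₁, h₁⟩ := ih₁ (fun l => emb (Sum.inl l)) (emb (Sum.inr q.start)) v
      fun l => hM (Sum.inl l)
    obtain ⟨v₂, h₂⟩ := ih₂ (fun l => emb (Sum.inr l)) exit v₁ fun l => hM (Sum.inr l)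
    exact ⟨v₂, h₁.trans h₂⟩
  | @case k f S S' t _ ih =>
    intro emb exit v hM
    obtain ⟨v', h'⟩ := ih (fun l => emb (some ⟨_, l⟩)) exit (S k).head?
      fun l => hM (some ⟨(S k).head?, l⟩)
    refine ⟨v', (Steps.trans (Steps.of_stepAux (hM _) ?_) h').mono (by omega)⟩
    exact congrArg (TM2.Cfg.mk _ _) (update_contents_work i o S k (S k).tail)
  | @loop_nil k f S hS =>
    intro emb exit v hM
    refine ⟨(S k).head?, Steps.of_stepAux (hM _) ?_⟩
    have hS' : update S k (S k).tail = S := by rw [hS, List.tail_nil, ← hS, update_eq_self]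
    refine (congrArg (TM2.Cfg.mk _ _) (update_contents_work i o S k (S k).tail)).trans ?_
    rw [hS']
    exact congrArg (fun l' : List Γ => TM2.Cfg.mk
      (some (l'.head?.elim exit fun a => emb (some ⟨a, (f a).start⟩))) (S k).head?
      (contents i o S)) hS
  | @loop_cons k f S S₁ S₂ a l t₁ t₂ hS _ _ ih₁ ih₂ =>
    intro emb exit v hM
    obtain ⟨v₁, h₁⟩ := ih₁ (fun l => emb (some ⟨a, l⟩)) (emb none) (some a)
      fun l => hM (some ⟨a, l⟩)
    obtain ⟨v₂, h₂⟩ := ih₂ emb exit v₁ hM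
    refine ⟨v₂, (Steps.trans (Steps.of_stepAux (hM _) ?_) (h₁.trans h₂)).mono (by omega)⟩
    refine (congrArg (TM2.Cfg.mk _ _) (update_contents_work i o S k (S k).tail)).trans ?_
    exact congrArg (fun l' : List Γ => TM2.Cfg.mk
      (some (l'.head?.elim exit fun a => emb (some ⟨a, (f a).start⟩))) l'.head?
      (contents i o (update S k l'.tail))) hS
  | mono _ ht ih =>
    intro emb exit v hM
    obtain ⟨v', h'⟩ := ih emb exit v hM
    exact ⟨v', h'.mono ht⟩

/-- The machine that pushes the input, symbol by symbol, on the stack `kin`, runs the program, and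
answers whether the stack `kout` is nonempty. -/
def machineCode [Inhabited Γ] (e : A → Γ) (kin kout : K) (p : StackProg K Γ) :
    Option (Option p.Label) →
      TM2.Stmt (Alphabet (K := K) A Γ) (Option (Option p.Label)) (Option Γ)
  | none => .pop .input (fun _ o => o.map e) (.branch Option.isSome
      (.push (.work kin) (fun v => v.getD default) (.goto fun _ => none))
      (.goto fun _ => some (some p.start)))
  | some none => .pop (.work kout) (fun _ o => o) (.push .output (fun v => v.isSome)
      (.load (fun _ => none) .halt))
  | some (some l) => p.code A (fun l => some (some l)) (some none) l

/-- A pop from the input and the push on `kin` form one machine step; the extra step is the pop that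
finds the input empty. The transfer reverses the input. -/
theorem steps_load [Inhabited Γ] (e : A → Γ) (kin kout : K) (p : StackProg K Γ) (i : List A) :
    ∀ (v : Option Γ) (S : K → List Γ),
      Steps (machineCode e kin kout p) ⟨some none, v, contents i [] S⟩
        ⟨some (some (some p.start)), none,
          contents [] [] (update S kin ((i.map e).reverse ++ S kin))⟩ (i.length + 1) := by
  induction i with
  | nil =>
    intro v S
    refine (Steps.of_stepAux rfl ?_).mono (by simp)
    exact congrArg (TM2.Cfg.mk _ _) ((update_contents_input [] [] [] S).trans (by simp))
  | cons a i ih =>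
    intro v S
    have h := ih (some (e a)) (update S kin (e a :: S kin))
    rw [update_idem, update_self] at h
    rw [List.map_cons, List.reverse_cons, List.append_assoc, List.singleton_append,
      List.length_cons, add_comm]
    refine Steps.trans (Steps.of_stepAux rfl ?_) h
    refine congrArg (TM2.Cfg.mk _ _) ?_
    rw [← update_contents_work]
    exact congrArg (fun C : ∀ k, List (Alphabet A Γ k) =>
        update C (MachineStack.work kin) (e a :: S kin))
      (update_contents_input (a :: i) i [] S)

/-- A function computed by a stack program in polynomial time is computed by a Turing machine in
polynomial time. -/
theorem tm2ComputableInPolyTime [Fintype K] [Fintype Γ] [Inhabited Γ] [Fintype A] {α : Type}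
    (enc : α → List A) (f : α → Bool) (e : A → Γ) (kin kout : K) (p : StackProg K Γ)
    (P : Polynomial ℕ)
    (h : ∀ a, ∃ l, (l ≠ [] ↔ f a = true) ∧ l.length ≤ 1 ∧
      Exec p (update (fun _ => []) kin ((enc a).map e).reverse) (update (fun _ => []) kout l)
        (P.eval (enc a).length)) :
    Nonempty (TM2ComputableInPolyTime enc Computability.encodeBool f) := by
  let tm : FinTM2 :=
    { K := MachineStack K
      k₀ := .input
      k₁ := .output
      Γ := Alphabet A Γ
      Λ := Option (Option p.Label)
      main := none
      σ := Option Γ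
      initialState := none
      Γk₀Fin := inferInstanceAs (Fintype A)
      m := machineCode e kin kout p }
  -- `X + 1` steps load the input, `P` steps run the program, one step gives the answer.
  refine ⟨⟨⟨tm, Equiv.refl A, Equiv.refl Bool⟩, P + Polynomial.X + 2, fun a => ?_⟩⟩
  have key : Steps (machineCode e kin kout p) (initList tm (enc a))
      (haltList tm (Computability.encodeBool (f a))) ((P + Polynomial.X + 2).eval (enc a).length) := by
    obtain ⟨l, hl, hl₁, hp⟩ := h a
    have h₁ := steps_load (A := A) e kin kout p (enc a) none (fun _ => [])
    obtain ⟨v, h₂⟩ := hp.steps (M := machineCode e kin kout p) [] [] (fun l => some (some l))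
      (some none) none fun l => rfl
    -- `haltList` requires every stack except the output to be empty and the register to be back at
    -- `none`. As `l` has at most one symbol, the pop that reads the answer also empties `kout`.
    have h₃ : Steps (machineCode e kin kout p)
        ⟨some (some none), v, contents [] [] (update (fun _ => []) kout l)⟩
        ⟨none, none, contents [] [f a] (fun _ => [])⟩ 1 := by
      refine Steps.of_stepAux rfl ?_
      have hl' : l.head?.isSome = f a := by
        rcases l with _ | ⟨x, l⟩
        · simpa using hl
        · simpa using hl
      have hl'' : l.tail = [] := List.length_eq_zero_iff.1 (by rw [List.length_tail]; omega)
      have hu : update (contents (A := A) [] [] (update (fun _ => []) kout l)) (.work kout) l.tail =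
          contents [] [] fun _ => [] := by
        rw [update_contents_work, update_idem, hl'']
        simp
      have hv : update (contents (A := A) [] [] (update (fun _ => []) kout l)) (.work kout)
          (update (fun _ => []) kout l kout).tail = contents [] [] fun _ => [] := by
        rw [update_self]
        exact hu
      have hw : (update (fun _ => []) kout l kout).head?.isSome = f a := by
        rw [update_self]
        exact hl'
      rw [← hw]
      exact congrArg (TM2.Cfg.mk none none) ((congrArg
        (fun C : ∀ k, List (Alphabet A Γ k) => update C MachineStack.output
          [(update (fun _ => []) kout l kout).head?.isSome]) hv).trans
        (update_contents_output [] [] _ _))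
    simp only [List.append_nil] at h₁
    have hi : contents (enc a) [] (fun _ => []) = (initList tm (enc a)).stk := by
      funext k
      rcases k with _ | _ | k <;> rfl
    have ho : contents [] [f a] (fun _ => []) =
        (haltList tm (Computability.encodeBool (f a))).stk := by
      funext k
      rcases k with _ | _ | k <;> rfl
    rw [hi] at h₁
    rw [ho] at h₃
    refine ((h₁.trans h₂).trans h₃).mono ?_
    simp
    omega
  choose n hn e using key
  rw [show List.map (Equiv.refl A).invFun (enc a) = enc a from List.map_id _,
    show List.map (Equiv.refl Bool).invFun (Computability.encodeBool (f a)) = _ from List.map_id _]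
  exact ⟨⟨n, e⟩, hn⟩

end Compilation

end StackProg

/-! ### Derivation and minimal models of HEF theories. -/

namespace CNF

section Minimality

variable {α : Type} {T : Theory α} {N D : Finset α}

/-- `c` derives `x` from `D`, relative to `N`: the body of `c` is in `D`, and `x` is the only head
atom of `c` that may be in `N`. -/
def Clause.Derives (c : Clause α) (N D : Finset α) (x : α) : Prop :=
  x ∈ c.head ∧ (∀ a ∈ c.head, a ∈ N → a = x) ∧ c.body ⊆ D

/-- Since the body lies in `D ⊆ M`, the clause can only be true through a head atom in `M ⊆ N`, and
`x` is the only candidate. -/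
theorem Clause.Derives.mem_of_isTrue {c : Clause α} {x : α} {M : Finset α} (h : c.Derives N D x)
    (hc : c.IsTrue M) (hM : M ⊆ N) (hD : D ⊆ M) : x ∈ M := by
  rcases hc with ⟨a, ha, haM⟩ | ⟨b, hb, hbM⟩
  · exact h.2.1 a ha (hM haM) ▸ haM
  · exact absurd (hD (h.2.2 hb)) hbM

variable [DecidableEq α]

/-- In a minimal model of a head-elementary-set-free theory, every atom is obtained by repeated
derivation. -/
theorem IsMinimalModel.subset_of_closed (hN : IsMinimalModel T N) (hT : IsHEF T)
    (hD : ∀ c ∈ T, ∀ x ∈ N, c.Derives N D x → x ∈ D) : N ⊆ D := by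
  by_contra hND
  -- `P` expresses unfoundedness; closure of `D` under derivation gives it for `N \ D`.
  let P : Finset α → Prop := fun Y => Y.Nonempty ∧ Y ⊆ N ∧ ∀ c ∈ T, ∀ x ∈ Y, c.body ⊆ N →
    x ∈ c.head → (∀ a ∈ c.head, a ∈ N → a = x) → (c.body ∩ Y).Nonempty
  have hP : P (N \ D) := by
    refine ⟨Finset.sdiff_nonempty.2 hND, Finset.sdiff_subset, fun c hc x hx hcN hxc hcx => ?_⟩
    by_contra he
    refine (Finset.mem_sdiff.1 hx).2 (hD c hc x (Finset.mem_sdiff.1 hx).1 ⟨hxc, hcx, ?_⟩)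
    intro b hb
    by_contra hbD
    exact he ⟨b, by simp [hb, hcN hb, hbD]⟩
  obtain ⟨Y, ⟨hY₀, hYN, hY⟩, hmin⟩ := WellFounded.has_min (wellFounded_lt (α := Finset α))
    {Y | P Y} ⟨_, hP⟩
  have hYe : IsElementary T Y := by
    refine ⟨hY₀, hYN.trans hN.1.1, fun Z hZ₀ hZ => ?_⟩
    -- The clause witnessing the failure of `P Z` is the outbound witness: its body avoids `Z` but
    -- meets `Y` by `P Y`, and its only head atom in `N` is already in `Z`.
    have hZP : ¬ P Z := fun h => hmin Z h hZ
    simp only [P, not_and] at hZP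
    have hZ' := hZP hZ₀ (hZ.subset.trans hYN)
    push Not at hZ'
    obtain ⟨c, hc, x, hxZ, hcN, hxc, hcx, he⟩ := hZ'
    obtain ⟨b, hb⟩ := hY c hc x (hZ.subset hxZ) hcN hxc hcx
    rw [Finset.mem_inter] at hb
    refine ⟨c, hc, ⟨x, by simp [hxc, hxZ]⟩, ⟨b, ?_⟩, he, ?_⟩
    · have hbZ : b ∉ Z := fun hbZ => by
        have : b ∈ c.body ∩ Z := by simp [hb.1, hbZ]
        simp [he] at this
      simp [hb.1, hb.2, hbZ]
    · refine Finset.eq_empty_of_forall_notMem fun a ha => ?_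
      simp only [Finset.mem_inter, Finset.mem_sdiff] at ha
      exact ha.2.2 (hcx a ha.1 (hYN ha.2.1) ▸ hxZ)
  -- Removing `Y` leaves a model: a clause that became false would have all its head atoms from `N`
  -- in `Y`, and by HEF there is just one, so that `P Y` applies.
  refine hN.2 (N \ Y) (Finset.sdiff_ssubset hYN hY₀)
    ⟨Finset.sdiff_subset.trans hN.1.1, fun c hc => ?_⟩
  by_contra hcf
  obtain ⟨hhead, hbody⟩ : (∀ a ∈ c.head, a ∈ N → a ∈ Y) ∧ ∀ {b}, b ∈ c.body → b ∈ N ∧ b ∉ Y := by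
    simpa [Clause.IsTrue, Finset.mem_sdiff] using hcf
  have hcN : c.body ⊆ N := fun b hb => (hbody hb).1
  rcases hN.1.2 c hc with ⟨a, ha, haN⟩ | ⟨b, hb, hbN⟩
  · have haY := hhead a ha haN
    have hca : ∀ a' ∈ c.head, a' ∈ N → a' = a := fun a' ha' haN' => by
      by_contra hne
      refine hT c hc ⟨Y, hYe, Finset.one_lt_card.2 ⟨a', ?_, a, ?_, hne⟩⟩
      · simp [ha', hhead a' ha' haN']
      · simp [ha, haY]
    obtain ⟨b, hb⟩ := hY c hc a haY hcN ha hca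
    rw [Finset.mem_inter] at hb
    exact (hbody hb.1).2 hb.2
  · exact hbN (hcN hb)

end Minimality

/-- The clause written as a pair of lists. -/
def clauseOf (p : List ℕ × List ℕ) : Clause ℕ := ⟨p.1.toFinset, p.2.toFinset⟩

theorem Input.mem_theory {I : Input} {c : Clause ℕ} :
    c ∈ I.theory ↔ ∃ p ∈ I.clauses, clauseOf p = c := by
  simp [Input.theory, clauseOf]

/-! ### Closure under derivation in boundedly many rounds. -/

section Derivation

open Classical in
/-- Add `x` if some clause derives it. -/
noncomputable def deriveAtom (cs : List (List ℕ × List ℕ)) (N D : Finset ℕ) (x : ℕ) : Finset ℕ :=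
  if ∃ p ∈ cs, (clauseOf p).Derives N D x then insert x D else D

/-- Try to derive each of the listed atoms, one after the other. -/
noncomputable def deriveAtoms (cs : List (List ℕ × List ℕ)) (N : Finset ℕ) (l : List ℕ)
    (D : Finset ℕ) : Finset ℕ :=
  l.foldl (deriveAtom cs N) D

variable {cs : List (List ℕ × List ℕ)} {N D : Finset ℕ} {l : List ℕ}

theorem subset_deriveAtom (x : ℕ) : D ⊆ deriveAtom cs N D x := by
  unfold deriveAtom
  split
  · exact Finset.subset_insert _ _
  · exact subset_rfl

theorem subset_deriveAtoms : D ⊆ deriveAtoms cs N l D := by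
  induction l generalizing D with
  | nil => exact subset_rfl
  | cons x l ih => exact (subset_deriveAtom x).trans ih

/-- Applied with `M` a set satisfying the clauses, for soundness, and with `M` the candidate set,
for boundedness. -/
theorem deriveAtoms_subset {M : Finset ℕ} (hl : ∀ x ∈ l, ∀ D ⊆ M, ∀ p ∈ cs,
    (clauseOf p).Derives N D x → x ∈ M) (hD : D ⊆ M) : deriveAtoms cs N l D ⊆ M := by
  induction l generalizing D with
  | nil => exact hD
  | cons x l ih =>
    refine ih (fun y hy => hl y (by simp [hy])) ?_
    unfold deriveAtom
    split_ifs with h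
    · obtain ⟨p, hp, h⟩ := h
      exact Finset.insert_subset (hl x (by simp) D hD p hp h) hD
    · exact hD

/-- `D` may grow during a round, but never shrinks; so a round that ends where it began changed
nothing at any step, and every test in it was made against `D` itself. -/
theorem mem_of_deriveAtoms_eq (h : deriveAtoms cs N l D = D) {x : ℕ} (hx : x ∈ l)
    {p : List ℕ × List ℕ} (hp : p ∈ cs) (hpx : (clauseOf p).Derives N D x) : x ∈ D := by
  induction l with
  | nil => simp at hx
  | cons y l ih =>
    have hy : deriveAtom cs N D y = D :=
      Finset.Subset.antisymm ((subset_deriveAtoms (l := l)).trans h.subset) (subset_deriveAtom y)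
    rcases List.mem_cons.1 hx with rfl | hx
    · rw [deriveAtom, if_pos ⟨p, hp, hpx⟩] at hy
      exact hy ▸ Finset.mem_insert_self x D
    · refine ih ?_ hx
      rw [deriveAtoms, List.foldl_cons, hy] at h
      exact h

/-- An increasing operation on the subsets of `N` reaches a fixed point after `card N` steps. -/
theorem iterate_isFixedPt_of_card_le {g : Finset ℕ → Finset ℕ} (hg : ∀ D, D ⊆ g D)
    (hN : ∀ D ⊆ N, g D ⊆ N) {m : ℕ} (hm : N.card ≤ m) : g (g^[m] ∅) = g^[m] ∅ := by
  have hsub : ∀ m, g^[m] ∅ ⊆ N := fun m => by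
    induction m with
    | zero => simp
    | succ m ih => rw [Function.iterate_succ_apply']; exact hN _ ih
  -- Until it becomes stationary, the sequence gains an element at each step.
  have key : ∀ m, g (g^[m] ∅) = g^[m] ∅ ∨ m < (g^[m + 1] ∅).card := fun m => by
    induction m with
    | zero =>
      by_cases h : g ∅ = ∅
      · exact Or.inl h
      · exact Or.inr (Finset.card_pos.2 (Finset.nonempty_iff_ne_empty.2 h))
    | succ m ih =>
      rcases ih with ih | ih
      · left
        rw [Function.iterate_succ_apply', ih, ih]
      · by_cases h : g (g^[m + 1] ∅) = g^[m + 1] ∅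
        · exact Or.inl h
        · right
          rw [Function.iterate_succ_apply' g (m + 1)]
          exact lt_of_le_of_lt ih (Finset.card_lt_card ((hg _).ssubset_of_ne (Ne.symm h)))
  rcases key m with h | h
  · exact h
  · exact absurd (Finset.card_le_card (hsub (m + 1))) (by omega)

/-- The atoms obtained by `m` rounds of derivation. -/
noncomputable def derived (I : Input) (m : ℕ) : Finset ℕ :=
  (deriveAtoms I.clauses I.set I.candidate)^[m] ∅

theorem derived_subset_of_isModel {I : Input} {M : Finset ℕ} (hM : ∀ c ∈ I.theory, c.IsTrue M)
    (hMN : M ⊆ I.set) (m : ℕ) : derived I m ⊆ M := by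
  induction m with
  | zero => simp [derived]
  | succ m ih =>
    rw [derived, Function.iterate_succ_apply']
    exact deriveAtoms_subset (fun x _ D hD p hp h =>
      h.mem_of_isTrue (hM _ (Input.mem_theory.2 ⟨p, hp, rfl⟩)) hMN hD) ih

theorem derived_subset (I : Input) (m : ℕ) : derived I m ⊆ I.set := by
  induction m with
  | zero => simp [derived]
  | succ m ih =>
    rw [derived, Function.iterate_succ_apply']
    exact deriveAtoms_subset (fun x hx _ _ _ _ _ => by simpa [Input.set] using hx) ih

/-- From left to right, the rounds have reached a fixed point, which is closed under derivation, and
HEF gives the inclusion. From right to left, a model `M ⊂ N` would contain all derived atoms, hence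
`N`. -/
theorem isMinimalModel_iff {I : Input} (hI : IsHEF I.theory) (hN : I.set ⊆ atoms I.theory) {m : ℕ}
    (hm : I.set.card ≤ m) :
    IsMinimalModel I.theory I.set ↔ I.set ⊆ derived I m ∧ ∀ c ∈ I.theory, c.IsTrue I.set := by
  constructor
  · intro h
    refine ⟨h.subset_of_closed hI fun c hc x hx hcx => ?_, h.1.2⟩
    obtain ⟨p, hp, rfl⟩ := Input.mem_theory.1 hc
    have hfix : deriveAtoms I.clauses I.set I.candidate (derived I m) = derived I m :=
      iterate_isFixedPt_of_card_le (fun _ => subset_deriveAtoms) (fun D hD =>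
        deriveAtoms_subset (fun x hx _ _ _ _ _ => by simpa [Input.set] using hx) hD) hm
    exact mem_of_deriveAtoms_eq hfix (by simpa [Input.set] using hx) hp hcx
  · rintro ⟨hD, hc⟩
    exact ⟨⟨hN, hc⟩, fun M hM hMm =>
      hM.2 (hD.trans (derived_subset_of_isModel hMm.2 hM.subset m))⟩

end Derivation

/-! ### Clauses written with status tags. -/

section Writing

/-- The status of an atom: not in the candidate set, in it but not derived, in it and currently
examined, in it and derived. -/
inductive Tag
  | out
  | rem
  | cur
  | der
deriving DecidableEq

instance : Fintype Tag := ⟨{.out, .rem, .cur, .der}, fun t => by cases t <;> simp⟩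

/-- The states of the scanning automata. -/
inductive ScanState
  | head
  | marked
  | body
  | bad
  | done
deriving DecidableEq

instance : Fintype ScanState :=
  ⟨{.head, .marked, .body, .bad, .done}, fun q => by cases q <;> simp⟩

/-- The work alphabet. -/
inductive WorkSymbol
  | bit (b : Bool)
  | tag (t : Tag)
  | arrow
  | period
  | bar
  | state (q : ScanState)
deriving DecidableEq, Fintype

instance : Inhabited WorkSymbol := ⟨.bar⟩

/-- The work symbol for an input symbol. -/
def Symbol.toWork : Symbol → WorkSymbol
  | .bit b => .bit b
  | .comma => .tag .out
  | .arrow => .arrow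
  | .period => .period
  | .bar => .bar

/-- The bits of an atom as work symbols. -/
def writeBits (a : ℕ) : List WorkSymbol := (Computability.encodeNat a).map .bit

/-- An atom followed by its tag. -/
def writeAtom (τ : ℕ → Tag) (a : ℕ) : List WorkSymbol := writeBits a ++ [.tag (τ a)]

/-- A list of atoms with tags. -/
def writeAtoms (τ : ℕ → Tag) (l : List ℕ) : List WorkSymbol := l.flatMap (writeAtom τ)

/-- A clause with tags. -/
def writeClause (τ : ℕ → Tag) (p : List ℕ × List ℕ) : List WorkSymbol :=
  writeAtoms τ p.1 ++ .arrow :: (writeAtoms τ p.2 ++ [.period])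

/-- A list of clauses with tags. -/
def writeClauses (τ : ℕ → Tag) (cs : List (List ℕ × List ℕ)) : List WorkSymbol :=
  cs.flatMap (writeClause τ)

theorem writeBits_injective : Function.Injective writeBits := by
  intro a b h
  have h' : Computability.encodeNat a = Computability.encodeNat b :=
    List.map_injective_iff.2 (fun _ _ h => WorkSymbol.bit.inj h) h
  rw [← Computability.decode_encodeNat a, h', Computability.decode_encodeNat]

theorem map_toWork_encodeAtoms (l : List ℕ) :
    (encodeAtoms l).map Symbol.toWork = writeAtoms (fun _ => .out) l := by
  simp [encodeAtoms, writeAtoms, List.map_flatMap, encodeAtom, Symbol.toWork, Function.comp_def]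
  rfl

theorem map_toWork_encode (I : Input) :
    I.encode.map Symbol.toWork =
      writeClauses (fun _ => .out) I.clauses ++ .bar :: writeAtoms (fun _ => .out) I.candidate := by
  simp [Input.encode, map_toWork_encodeAtoms, writeClauses, List.map_flatMap, encodeClause,
    Symbol.toWork]
  rfl

theorem length_writeAtoms (τ τ' : ℕ → Tag) (l : List ℕ) :
    (writeAtoms τ l).length = (writeAtoms τ' l).length := by
  simp [writeAtoms, writeAtom]

/-- Retagging preserves length, so one length bounds the cost of all passes. -/
theorem length_writeClauses (τ τ' : ℕ → Tag) (cs : List (List ℕ × List ℕ)) :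
    (writeClauses τ cs).length = (writeClauses τ' cs).length := by
  simp only [writeClauses, writeClause, List.length_flatMap, List.length_append, List.length_cons,
    length_writeAtoms τ τ']

theorem length_le_length_writeAtoms (τ : ℕ → Tag) (l : List ℕ) :
    l.length ≤ (writeAtoms τ l).length := by
  induction l with
  | nil => simp
  | cons a l ih =>
    simp only [writeAtoms, List.flatMap_cons, List.length_append, List.length_cons, writeAtom,
      List.length_nil] at ih ⊢
    omega

end Writing

/-! ### Finite automata reading the written clauses. -/

section Scanning

/-- The automaton looking for a clause with a `cur` head atom, no other head atom in the candidate
set, and only derived body atoms. -/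
def searchStep : ScanState → WorkSymbol → ScanState
  | .head, .tag .cur => .marked
  | .head, .tag .rem => .bad
  | .head, .tag .der => .bad
  | .head, .arrow => .bad
  | .marked, .tag .rem => .bad
  | .marked, .tag .der => .bad
  | .marked, .arrow => .body
  | .body, .tag .out => .bad
  | .body, .tag .rem => .bad
  | .body, .tag .cur => .bad
  | .body, .period => .done
  | .bad, .period => .head
  | q, _ => q

/-- The automaton checking that no atom is tagged `rem`, and that each clause has a derived head
atom or a body atom outside of the candidate set. -/
def checkStep : ScanState → WorkSymbol → ScanState
  | .bad, _ => .bad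
  | _, .tag .rem => .bad
  | .head, .tag .der => .done
  | .head, .arrow => .body
  | .body, .tag .out => .done
  | .body, .period => .bad
  | .done, .period => .head
  | q, _ => q

theorem foldl_writeAtoms {δ : ScanState → WorkSymbol → ScanState} (hδ : ∀ q b, δ q (.bit b) = q)
    (τ : ℕ → Tag) (l : List ℕ) (q : ScanState) :
    (writeAtoms τ l).foldl δ q = l.foldl (fun q a => δ q (.tag (τ a))) q := by
  have hb : ∀ (l : List Bool) (q), (l.map WorkSymbol.bit).foldl δ q = q := by
    intro l
    induction l with
    | nil => simp
    | cons b l ih => intro q; simp [hδ, ih]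
  induction l generalizing q with
  | nil => rfl
  | cons a l ih =>
    rw [writeAtoms, List.flatMap_cons, List.foldl_append, ← writeAtoms, writeAtom,
      List.foldl_append, writeBits, hb, List.foldl_cons, List.foldl_nil, ih, List.foldl_cons]

theorem foldl_writeClause {δ : ScanState → WorkSymbol → ScanState} (hδ : ∀ q b, δ q (.bit b) = q)
    (τ : ℕ → Tag) (p : List ℕ × List ℕ) (q : ScanState) :
    (writeClause τ p).foldl δ q =
      δ (p.2.foldl (fun q a => δ q (.tag (τ a)))
        (δ (p.1.foldl (fun q a => δ q (.tag (τ a))) q) .arrow)) .period := by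
  rw [writeClause, List.foldl_append, List.foldl_cons, List.foldl_append, List.foldl_cons,
    List.foldl_nil, foldl_writeAtoms hδ, foldl_writeAtoms hδ]

/-- The clause is found by `searchStep`. -/
def Found (τ : ℕ → Tag) (p : List ℕ × List ℕ) : Prop :=
  (∃ a ∈ p.1, τ a = .cur) ∧ (∀ a ∈ p.1, τ a = .cur ∨ τ a = .out) ∧ ∀ b ∈ p.2, τ b = .der

theorem foldl_const_of_fixed {β : Type} {f : ScanState → β → ScanState} {q : ScanState}
    (h : ∀ b, f q b = q) (l : List β) : l.foldl f q = q := by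
  induction l with
  | nil => rfl
  | cons b l ih => rw [List.foldl_cons, h, ih]

theorem searchStep_marked_tag (t : Tag) : searchStep .marked (.tag t) =
    if t = .cur ∨ t = .out then .marked else .bad := by
  cases t <;> rfl

theorem search_marked (τ : ℕ → Tag) (l : List ℕ) :
    l.foldl (fun q a => searchStep q (.tag (τ a))) .marked =
      if ∀ a ∈ l, τ a = .cur ∨ τ a = .out then .marked else .bad := by
  induction l with
  | nil => simp
  | cons a l ih =>
    have hb : l.foldl (fun q a => searchStep q (.tag (τ a))) .bad = .bad :=
      foldl_const_of_fixed (fun _ => rfl) l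
    rw [List.foldl_cons, searchStep_marked_tag]
    cases h : τ a <;> simp [h, ih, hb]

theorem searchStep_head_tag (t : Tag) : searchStep .head (.tag t) =
    if t = .cur then .marked else if t = .out then .head else .bad := by
  cases t <;> rfl

theorem search_head (τ : ℕ → Tag) (l : List ℕ) :
    l.foldl (fun q a => searchStep q (.tag (τ a))) .head =
      if ∀ a ∈ l, τ a = .cur ∨ τ a = .out then
        (if ∃ a ∈ l, τ a = .cur then .marked else .head) else .bad := by
  induction l with
  | nil => simp
  | cons a l ih =>
    have hb : l.foldl (fun q a => searchStep q (.tag (τ a))) .bad = .bad :=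
      foldl_const_of_fixed (fun _ => rfl) l
    rw [List.foldl_cons, searchStep_head_tag]
    cases h : τ a <;> simp [h, ih, hb, search_marked]

theorem searchStep_body_tag (t : Tag) : searchStep .body (.tag t) =
    if t = .der then .body else .bad := by
  cases t <;> rfl

theorem search_body (τ : ℕ → Tag) (l : List ℕ) :
    l.foldl (fun q a => searchStep q (.tag (τ a))) .body =
      if ∀ a ∈ l, τ a = .der then .body else .bad := by
  induction l with
  | nil => simp
  | cons a l ih =>
    have hb : l.foldl (fun q a => searchStep q (.tag (τ a))) .bad = .bad :=
      foldl_const_of_fixed (fun _ => rfl) l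
    rw [List.foldl_cons, searchStep_body_tag]
    cases h : τ a <;> simp [h, ih, hb]

open Classical in
theorem search_clause (τ : ℕ → Tag) (p : List ℕ × List ℕ) :
    (writeClause τ p).foldl searchStep .head = if Found τ p then .done else .head := by
  rw [foldl_writeClause (by rintro (_ | _) _ <;> rfl), search_head]
  by_cases h₁ : ∀ a ∈ p.1, τ a = .cur ∨ τ a = .out
  · by_cases h₂ : ∃ a ∈ p.1, τ a = .cur
    · rw [if_pos h₁, if_pos h₂]
      change searchStep (p.2.foldl _ .body) _ = _
      rw [search_body]
      by_cases h₃ : ∀ b ∈ p.2, τ b = .der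
      · rw [if_pos h₃, if_pos ⟨h₂, h₁, h₃⟩]
        rfl
      · rw [if_neg h₃, if_neg fun h => h₃ h.2.2]
        rfl
    · rw [if_pos h₁, if_neg h₂, if_neg fun h => h₂ h.1]
      change searchStep (p.2.foldl _ .bad) _ = _
      rw [foldl_const_of_fixed fun _ => rfl]
      rfl
  · rw [if_neg h₁, if_neg fun h => h₁ h.2.1]
    change searchStep (p.2.foldl _ .bad) _ = _
    rw [foldl_const_of_fixed fun _ => rfl]
    rfl

/-- In `searchStep` the state `done` is absorbing, while `bad` lasts only to the end of the clause:
the scan computes a disjunction over clauses. -/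
theorem search_eq_done_iff (τ : ℕ → Tag) (cs : List (List ℕ × List ℕ)) :
    (writeClauses τ cs).foldl searchStep .head = .done ↔ ∃ p ∈ cs, Found τ p := by
  induction cs with
  | nil => simp [writeClauses]
  | cons p cs ih =>
    rw [writeClauses, List.flatMap_cons, List.foldl_append, search_clause, ← writeClauses]
    by_cases h : Found τ p
    · rw [if_pos h, foldl_const_of_fixed fun _ => rfl]
      simp [h]
    · rw [if_neg h, ih]
      simp [h]

/-- The clause is accepted by `checkStep`. -/
def Accepted (τ : ℕ → Tag) (p : List ℕ × List ℕ) : Prop :=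
  (∀ a ∈ p.1, τ a ≠ .rem) ∧ (∀ b ∈ p.2, τ b ≠ .rem) ∧
    ((∃ a ∈ p.1, τ a = .der) ∨ ∃ b ∈ p.2, τ b = .out)

theorem checkStep_done_tag (t : Tag) : checkStep .done (.tag t) =
    if t = .rem then .bad else .done := by
  cases t <;> rfl

theorem check_done (τ : ℕ → Tag) (l : List ℕ) :
    l.foldl (fun q a => checkStep q (.tag (τ a))) .done =
      if ∀ a ∈ l, τ a ≠ .rem then .done else .bad := by
  induction l with
  | nil => simp
  | cons a l ih =>
    have hb : l.foldl (fun q a => checkStep q (.tag (τ a))) .bad = .bad :=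
      foldl_const_of_fixed (fun _ => rfl) l
    rw [List.foldl_cons, checkStep_done_tag]
    cases h : τ a <;> simp [h, ih, hb]

theorem checkStep_head_tag (t : Tag) : checkStep .head (.tag t) =
    if t = .rem then .bad else if t = .der then .done else .head := by
  cases t <;> rfl

theorem check_head (τ : ℕ → Tag) (l : List ℕ) :
    l.foldl (fun q a => checkStep q (.tag (τ a))) .head =
      if ∀ a ∈ l, τ a ≠ .rem then (if ∃ a ∈ l, τ a = .der then .done else .head) else .bad := by
  induction l with
  | nil => simp
  | cons a l ih =>
    have hb : l.foldl (fun q a => checkStep q (.tag (τ a))) .bad = .bad :=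
      foldl_const_of_fixed (fun _ => rfl) l
    rw [List.foldl_cons, checkStep_head_tag]
    cases h : τ a <;> simp [h, ih, hb, check_done]

theorem checkStep_body_tag (t : Tag) : checkStep .body (.tag t) =
    if t = .rem then .bad else if t = .out then .done else .body := by
  cases t <;> rfl

theorem check_body (τ : ℕ → Tag) (l : List ℕ) :
    l.foldl (fun q a => checkStep q (.tag (τ a))) .body =
      if ∀ a ∈ l, τ a ≠ .rem then (if ∃ a ∈ l, τ a = .out then .done else .body) else .bad := by
  induction l with
  | nil => simp
  | cons a l ih =>
    have hb : l.foldl (fun q a => checkStep q (.tag (τ a))) .bad = .bad :=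
      foldl_const_of_fixed (fun _ => rfl) l
    rw [List.foldl_cons, checkStep_body_tag]
    cases h : τ a <;> simp [h, ih, hb, check_done]

open Classical in
theorem check_clause (τ : ℕ → Tag) (p : List ℕ × List ℕ) :
    (writeClause τ p).foldl checkStep .head = if Accepted τ p then .head else .bad := by
  rw [foldl_writeClause (by rintro (_ | _) _ <;> rfl), check_head]
  by_cases h₁ : ∀ a ∈ p.1, τ a ≠ .rem
  · by_cases h₂ : ∃ a ∈ p.1, τ a = .der
    · rw [if_pos h₁, if_pos h₂]
      change checkStep (p.2.foldl _ .done) _ = _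
      rw [check_done]
      by_cases h₃ : ∀ b ∈ p.2, τ b ≠ .rem
      · rw [if_pos h₃, if_pos ⟨h₁, h₃, Or.inl h₂⟩]
        rfl
      · rw [if_neg h₃, if_neg fun h => h₃ h.2.1]
        rfl
    · rw [if_pos h₁, if_neg h₂]
      change checkStep (p.2.foldl _ .body) _ = _
      rw [check_body]
      by_cases h₃ : ∀ b ∈ p.2, τ b ≠ .rem
      · by_cases h₄ : ∃ b ∈ p.2, τ b = .out
        · rw [if_pos h₃, if_pos h₄, if_pos ⟨h₁, h₃, Or.inr h₄⟩]
          rfl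
        · rw [if_pos h₃, if_neg h₄, if_neg fun h => h.2.2.elim h₂ h₄]
          rfl
      · rw [if_neg h₃, if_neg fun h => h₃ h.2.1]
        rfl
  · rw [if_neg h₁, if_neg fun h => h₁ h.1]
    change checkStep (p.2.foldl _ .bad) _ = _
    rw [foldl_const_of_fixed fun _ => rfl]
    rfl

/-- Dually to the search, `bad` is absorbing and `done` lasts only to the end of the clause, which
gives a conjunction. -/
theorem check_ne_bad_iff (τ : ℕ → Tag) (cs : List (List ℕ × List ℕ)) :
    (writeClauses τ cs).foldl checkStep .head ≠ .bad ↔ ∀ p ∈ cs, Accepted τ p := by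
  induction cs with
  | nil => simp [writeClauses]
  | cons p cs ih =>
    rw [writeClauses, List.flatMap_cons, List.foldl_append, check_clause, ← writeClauses]
    by_cases h : Accepted τ p
    · rw [if_pos h, ih]
      simp [h]
    · rw [if_neg h, foldl_const_of_fixed fun _ => rfl]
      simp [h]

end Scanning

/-! ### Correctness of the algorithm on tags. -/

section Tagging

open Function

/-- Change the tag of the atom `x`. -/
def mark (g : Tag → Tag) (τ : ℕ → Tag) (x : ℕ) : ℕ → Tag := update τ x (g (τ x))

/-- Tag a remaining atom as current. -/
def Tag.toCur : Tag → Tag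
  | .rem => .cur
  | t => t

/-- Replace the tag of a current atom. -/
def Tag.ofCur (t : Tag) : Tag → Tag
  | .cur => t
  | t' => t'

/-- Test whether `x` can be derived, and tag it accordingly. -/
def examine (cs : List (List ℕ × List ℕ)) (τ : ℕ → Tag) (x : ℕ) : ℕ → Tag :=
  mark (Tag.ofCur (if (writeClauses (mark .toCur τ x) cs).foldl searchStep .head = .done then .der
    else .rem)) (mark .toCur τ x) x

/-- The tags describing the candidate set `N` and its subset `D` of derived atoms. -/
def tagging (N D : Finset ℕ) (a : ℕ) : Tag :=
  if a ∈ D then .der else if a ∈ N then .rem else .out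

theorem foldl_mark_rem (l : List ℕ) (N : Finset ℕ) :
    l.foldl (mark fun _ => .rem) (tagging N ∅) = tagging (N ∪ l.toFinset) ∅ := by
  induction l generalizing N with
  | nil => simp
  | cons x l ih =>
    have h : mark (fun _ => .rem) (tagging N ∅) x = tagging (insert x N) ∅ := by
      funext a
      by_cases ha : a = x <;> simp [mark, tagging, ha]
    rw [List.foldl_cons, h, ih, List.toFinset_cons, Finset.union_insert, Finset.insert_union]

theorem found_iff {N D : Finset ℕ} (hD : D ⊆ N) {x : ℕ} (hx : x ∈ N) (hxD : x ∉ D)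
    (p : List ℕ × List ℕ) :
    Found (mark .toCur (tagging N D) x) p ↔ (clauseOf p).Derives N D x := by
  have hcur : ∀ a, mark .toCur (tagging N D) x a = .cur ↔ a = x := by
    intro a
    by_cases ha : a = x
    · simp [mark, ha, tagging, hx, hxD, Tag.toCur]
    · rw [mark, update_of_ne ha, tagging]
      split_ifs <;> simp [ha]
  have hout : ∀ a, mark .toCur (tagging N D) x a = .out ↔ a ∉ N := by
    intro a
    by_cases ha : a = x
    · simp [mark, ha, tagging, hx, hxD, Tag.toCur]
    · rw [mark, update_of_ne ha, tagging]
      split_ifs with h₁ h₂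
      · simp [hD h₁]
      · simp [h₂]
      · simp [h₂]
  have hder : ∀ a, mark .toCur (tagging N D) x a = .der ↔ a ∈ D := by
    intro a
    by_cases ha : a = x
    · simp [mark, ha, tagging, hx, hxD, Tag.toCur]
    · rw [mark, update_of_ne ha, tagging]
      split_ifs with h₁ h₂
      · simp [h₁]
      · simp [h₁]
      · simp [h₁]
  simp only [Found, Clause.Derives, clauseOf, hcur, hout, hder, List.mem_toFinset,
    exists_eq_right, Finset.subset_iff]
  refine and_congr_right fun _ => and_congr_left fun _ => forall₂_congr fun a _ => ?_
  tauto

/-- If `x` is already derived, no tag becomes `cur` and both markings are void, whatever the search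
finds. Otherwise `cur` singles out `x`, and `found_iff` identifies the search with derivability. -/
theorem examine_tagging {N D : Finset ℕ} (hD : D ⊆ N) {x : ℕ} (hx : x ∈ N)
    (cs : List (List ℕ × List ℕ)) :
    examine cs (tagging N D) x = tagging N (deriveAtom cs N D x) := by
  by_cases hxD : x ∈ D
  · have h₁ : deriveAtom cs N D x = D := by
      rw [deriveAtom, Finset.insert_eq_of_mem hxD, ite_self]
    have h₂ : ∀ t, mark (Tag.ofCur t) (mark .toCur (tagging N D) x) x = tagging N D := by
      intro t
      simp [mark, tagging, hxD, Tag.toCur, Tag.ofCur]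
    rw [h₁, examine, h₂]
  · have h : ∀ t, mark (Tag.ofCur t) (mark .toCur (tagging N D) x) x =
        update (tagging N D) x t := by
      intro t
      simp [mark, tagging, hx, hxD, Tag.toCur, Tag.ofCur]
    rw [examine, h, deriveAtom]
    have hs := (search_eq_done_iff (mark .toCur (tagging N D) x) cs).trans
      (exists_congr fun p => and_congr_right fun _ => found_iff hD hx hxD p)
    funext a
    by_cases hd : ∃ p ∈ cs, (clauseOf p).Derives N D x
    · rw [if_pos (hs.2 hd), if_pos hd]
      by_cases ha : a = x <;> simp [tagging, ha]
    · rw [if_neg fun h => hd (hs.1 h), if_neg hd]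
      by_cases ha : a = x <;> simp [tagging, ha, hx, hxD]

theorem foldl_examine {N D : Finset ℕ} (hD : D ⊆ N) {l : List ℕ} (hl : ∀ x ∈ l, x ∈ N)
    (cs : List (List ℕ × List ℕ)) :
    l.foldl (examine cs) (tagging N D) = tagging N (deriveAtoms cs N l D) := by
  induction l generalizing D with
  | nil => rfl
  | cons x l ih =>
    have hx := hl x (by simp)
    have hD' : deriveAtom cs N D x ⊆ N := by
      unfold deriveAtom
      split
      · exact Finset.insert_subset hx hD
      · exact hD
    rw [List.foldl_cons, examine_tagging hD hx, ih hD' fun y hy => hl y (by simp [hy])]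
    rfl

/-- The tags after `m` rounds. -/
def finalTags (I : Input) (m : ℕ) : ℕ → Tag :=
  (fun τ => I.candidate.foldl (examine I.clauses) τ)^[m]
    (I.candidate.foldl (mark fun _ => .rem) fun _ => .out)

theorem finalTags_eq (I : Input) (m : ℕ) : finalTags I m = tagging I.set (derived I m) := by
  induction m with
  | zero =>
    have h := foldl_mark_rem I.candidate ∅
    have h₀ : tagging ∅ ∅ = fun _ => .out := by
      funext a
      simp [tagging]
    rw [h₀, Finset.empty_union] at h
    exact h
  | succ m ih =>
    rw [finalTags, derived, iterate_succ_apply', iterate_succ_apply', ← finalTags, ih, ← derived]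
    exact foldl_examine (derived_subset I m) (fun x hx => by simpa [Input.set] using hx) _

/-- The number of rounds that are performed. -/
def rounds (I : Input) : ℕ := (writeAtoms (fun _ => .out) I.candidate).length

/-- The answer of the algorithm. -/
def answer (I : Input) : Bool :=
  decide ((writeClauses (finalTags I (rounds I)) I.clauses).foldl checkStep .head ≠ .bad)

/-- The final check sees only atoms occurring in clauses; as `N ⊆ atoms`, the absence of `rem` there
means that all of `N` is derived. Then `der` marks exactly the atoms of `N`, and the rest of the
check is truth in `N`. -/
theorem answer_eq_true_iff {I : Input} (hI : IsHEF I.theory) (hN : I.set ⊆ atoms I.theory) :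
    answer I = true ↔ IsMinimalModel I.theory I.set := by
  -- Each listed atom ends with a tag symbol, so there are at least as many symbols, hence rounds,
  -- as atoms.
  have hm : I.set.card ≤ rounds I :=
    (List.toFinset_card_le _).trans (length_le_length_writeAtoms _ _)
  rw [isMinimalModel_iff hI hN hm, answer, decide_eq_true_iff, check_ne_bad_iff, finalTags_eq]
  set D := derived I (rounds I)
  have hD : D ⊆ I.set := derived_subset I _
  have hrem : ∀ a, tagging I.set D a ≠ .rem ↔ (a ∈ I.set → a ∈ D) := by
    intro a
    unfold tagging
    split_ifs <;> simp_all
  have hder : ∀ a, tagging I.set D a = .der ↔ a ∈ D := by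
    intro a
    unfold tagging
    split_ifs <;> simp_all
  have hout : ∀ a, tagging I.set D a = .out ↔ a ∉ I.set := by
    intro a
    unfold tagging
    split_ifs with h₁ h₂
    · simp [hD h₁]
    · simp [h₂]
    · simp [h₂]
  simp only [Accepted, hrem, hder, hout]
  constructor
  · intro h
    refine ⟨fun x hx => ?_, fun c hc => ?_⟩
    · obtain ⟨c, hc, hxc⟩ := Finset.mem_biUnion.1 (hN hx)
      obtain ⟨p, hp, rfl⟩ := Input.mem_theory.1 hc
      rcases Finset.mem_union.1 hxc with h' | h'
      · exact (h p hp).1 x (List.mem_toFinset.1 h') hx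
      · exact (h p hp).2.1 x (List.mem_toFinset.1 h') hx
    · obtain ⟨p, hp, rfl⟩ := Input.mem_theory.1 hc
      rcases (h p hp).2.2 with ⟨a, ha, haD⟩ | ⟨b, hb, hbN⟩
      · exact Or.inl ⟨a, List.mem_toFinset.2 ha, hD haD⟩
      · exact Or.inr ⟨b, List.mem_toFinset.2 hb, hbN⟩
  · rintro ⟨hND, hc⟩ p hp
    refine ⟨fun a _ ha => hND ha, fun a _ ha => hND ha, ?_⟩
    rcases hc _ (Input.mem_theory.2 ⟨p, hp, rfl⟩) with ⟨a, ha, haN⟩ | ⟨b, hb, hbN⟩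
    · exact Or.inl ⟨a, List.mem_toFinset.1 ha, hND haN⟩
    · exact Or.inr ⟨b, List.mem_toFinset.1 hb, hbN⟩

end Tagging

end CNF

/-! ### Rules for executions, and elementary programs. -/

namespace StackProg

open Function

variable {K Γ : Type} [DecidableEq K] {S S' S₁ S₂ : K → List Γ} {k k' : K} {t t₁ t₂ : ℕ}

/-- Pour a stack into another one. -/
def move (k k' : K) : StackProg K Γ := loop k fun a => push k' a

/-- Empty a stack. -/
def clear (k : K) : StackProg K Γ := loop k fun _ => skip

theorem Exec.congr {p : StackProg K Γ} (h : Exec p S S₁ t₁) (hS : S₁ = S₂) (ht : t₁ ≤ t₂) :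
    Exec p S S₂ t₂ :=
  hS ▸ h.mono ht

/-- Here and in the next rules the updated stacks are given up to an equation, so that
configurations can be kept in the form `regs ..`. -/
theorem Exec.push_of_eq {a : Γ} (h : update S k (a :: S k) = S₁) : Exec (.push k a) S S₁ 1 :=
  h ▸ Exec.push k a S

theorem Exec.case_nil {f : Option Γ → StackProg K Γ} (h : S k = []) (hf : Exec (f none) S S' t) :
    Exec (.case k f) S S' (t + 1) := by
  refine Exec.case ?_
  rw [h, List.tail_nil, ← h, update_eq_self, h]
  exact hf

theorem Exec.case_cons {f : Option Γ → StackProg K Γ} {a : Γ} {l : List Γ} (h : S k = a :: l)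
    (hu : update S k l = S₁) (hf : Exec (f (some a)) S₁ S' t) : Exec (.case k f) S S' (t + 1) := by
  refine Exec.case ?_
  rw [h, List.tail_cons, hu]
  exact hf

theorem Exec.loop_step {f : Γ → StackProg K Γ} {a : Γ} {l : List Γ} (h : S k = a :: l)
    (hu : update S k l = S₁) (hf : Exec (f a) S₁ S₂ t₁) (hl : Exec (loop k f) S₂ S' t₂) :
    Exec (loop k f) S S' (t₂ + (t₁ + 1)) := by
  subst hu
  exact (Exec.loop_cons h hf hl).mono (by omega)

theorem exec_move (h : k ≠ k') (S : K → List Γ) :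
    Exec (move k k') S (update (update S k []) k' ((S k).reverse ++ S k'))
      (2 * (S k).length + 1) := by
  generalize hl : S k = l
  induction l generalizing S with
  | nil =>
    refine (Exec.loop_nil hl).congr ?_ (by simp)
    rw [← hl, update_eq_self, hl, List.reverse_nil, List.nil_append, update_eq_self]
  | cons a l ih =>
    refine Exec.congr (.loop_step hl rfl (Exec.push _ _ _) (ih _ ?_)) ?_
      (by rw [List.length_cons]; omega)
    · rw [update_of_ne h, update_self]
    · funext j
      by_cases hj : j = k'
      · subst hj
        simp [h.symm]
      · by_cases hj' : j = k
        · subst hj'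
          simp [hj]
        · simp [hj, hj']

theorem exec_clear (k : K) (S : K → List Γ) :
    Exec (clear k) S (update S k []) (2 * (S k).length + 1) := by
  generalize hl : S k = l
  induction l generalizing S with
  | nil => exact (Exec.loop_nil hl).congr (by rw [← hl, update_eq_self]) (by simp)
  | cons a l ih =>
    exact (Exec.loop_step hl rfl (Exec.skip _) (ih _ (update_self _ _ _))).congr
      (by rw [update_idem]) (by rw [List.length_cons]; omega)

end StackProg

/-! ### Stack layout of the checking program. -/

namespace CNF

open Function StackProg

/-- The stacks of the minimal model checking program. -/
inductive Reg
  | input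
  | work
  | workDone
  | cand
  | candDone
  | atom
  | atomDone
  | flag
  | count
deriving DecidableEq

instance : Fintype Reg :=
  ⟨{.input, .work, .workDone, .cand, .candDone, .atom, .atomDone, .flag, .count},
    fun k => by cases k <;> simp⟩

/-- The stack contents, listed. -/
def regs (i w w' c c' x x' q r : List WorkSymbol) : Reg → List WorkSymbol
  | .input => i
  | .work => w
  | .workDone => w'
  | .cand => c
  | .candDone => c'
  | .atom => x
  | .atomDone => x'
  | .flag => q
  | .count => r

/-- Programs for minimal model checking. -/
abbrev Prog : Type := StackProg Reg WorkSymbol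

section Regs

variable {i w w' c c' x x' q r l : List WorkSymbol}

theorem update_regs_input : update (regs i w w' c c' x x' q r) .input l = regs l w w' c c' x x' q r := by
  funext k; cases k <;> rfl

theorem update_regs_work : update (regs i w w' c c' x x' q r) .work l = regs i l w' c c' x x' q r := by
  funext k; cases k <;> rfl

theorem update_regs_workDone : update (regs i w w' c c' x x' q r) .workDone l = regs i w l c c' x x' q r := by
  funext k; cases k <;> rfl

theorem update_regs_cand : update (regs i w w' c c' x x' q r) .cand l = regs i w w' l c' x x' q r := by
  funext k; cases k <;> rfl

theorem update_regs_candDone : update (regs i w w' c c' x x' q r) .candDone l = regs i w w' c l x x' q r := by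
  funext k; cases k <;> rfl

theorem update_regs_atom : update (regs i w w' c c' x x' q r) .atom l = regs i w w' c c' l x' q r := by
  funext k; cases k <;> rfl

theorem update_regs_atomDone : update (regs i w w' c c' x x' q r) .atomDone l = regs i w w' c c' x l q r := by
  funext k; cases k <;> rfl

theorem update_regs_flag : update (regs i w w' c c' x x' q r) .flag l = regs i w w' c c' x x' l r := by
  funext k; cases k <;> rfl

theorem update_regs_count : update (regs i w w' c c' x x' q r) .count l = regs i w w' c c' x x' q l := by
  funext k; cases k <;> rfl

theorem exec_move_workDone_work :
    Exec (move .workDone .work) (regs i w w' c c' x x' q r)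
      (regs i (w'.reverse ++ w) [] c c' x x' q r) (2 * w'.length + 1) :=
  (exec_move (by decide) _).congr
    ((congrArg (fun S => update S _ _) update_regs_workDone).trans update_regs_work) le_rfl

theorem exec_move_candDone_cand :
    Exec (move .candDone .cand) (regs i w w' c c' x x' q r)
      (regs i w w' (c'.reverse ++ c) [] x x' q r) (2 * c'.length + 1) :=
  (exec_move (by decide) _).congr
    ((congrArg (fun S => update S _ _) update_regs_candDone).trans update_regs_cand) le_rfl

theorem exec_move_atomDone_atom :
    Exec (move .atomDone .atom) (regs i w w' c c' x x' q r)
      (regs i w w' c c' (x'.reverse ++ x) [] q r) (2 * x'.length + 1) :=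
  (exec_move (by decide) _).congr
    ((congrArg (fun S => update S _ _) update_regs_atomDone).trans update_regs_atom) le_rfl

end Regs

theorem writeAtoms_cons (τ : ℕ → Tag) (a : ℕ) (l : List ℕ) :
    writeAtoms τ (a :: l) = writeBits a ++ .tag (τ a) :: writeAtoms τ l := by
  simp [writeAtoms, writeAtom]

/-! ### Retagging all occurrences of one atom. -/

section Marking

/-- Process one symbol of the written clauses: compare the bits with the current atom, and apply
`g` to the tag in the case of equality. -/
def markSymbol (g : Tag → Tag) : WorkSymbol → Prog
  | .bit b =>
    .seq (.push .workDone (.bit b)) (.case .atom fun o =>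
      match o with
      | none => .push .flag .bar
      | some a => .seq (.push .atomDone a) (if a = .bit b then .skip else .push .flag .bar))
  | .tag t =>
    .seq (.case .atom fun o =>
      match o with
      | none => .skip
      | some a => .seq (.push .atom a) (.push .flag .bar))
    (.seq (.case .flag fun o =>
      match o with
      | none => .push .workDone (.tag (g t))
      | some _ => .push .workDone (.tag t))
    (.seq (clear .flag) (move .atomDone .atom)))
  | a => .push .workDone a

/-- Apply `g` to the tags of the current atom. -/
def markProg (g : Tag → Tag) : Prog :=
  .seq (.loop .work (markSymbol g)) (move .workDone .work)

variable {i w w' c c' x x' q r : List WorkSymbol} {S : Reg → List WorkSymbol} {t : ℕ}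

/-- The hypothesis `h` runs the rest of the loop. The occurrence equals the current atom iff no
mismatch is on `flag` and no bit is left on `atom`; pouring `atomDone` back restores the atom for
the next comparison. -/
theorem exec_mark_tag (g : Tag → Tag) (s : Tag)
    (h : Exec (.loop .work (markSymbol g)) (regs i w
      (.tag (if q = [] ∧ x = [] then g s else s) :: w') c c' (x'.reverse ++ x) [] [] r) S t) :
    Exec (.loop .work (markSymbol g)) (regs i (.tag s :: w) w' c c' x x' q r) S
      (t + (2 * x'.length + 2 * q.length + 20)) := by
  refine Exec.mono (.loop_step rfl update_regs_work
    (t₁ := 2 * x'.length + 2 * q.length + 12) ?_ h) (by omega)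
  have h₁ : Exec (.case .atom fun o =>
      match o with
      | none => .skip
      | some a => .seq (.push .atom a) (.push .flag .bar)) (regs i w w' c c' x x' q r)
      (regs i w w' c c' x x' (if x = [] then q else .bar :: q) r) 3 := by
    rcases x with _ | ⟨a, x⟩
    · exact Exec.mono (.case_nil rfl (.skip _)) (by omega)
    · exact Exec.case_cons rfl update_regs_atom (.seq (.push_of_eq update_regs_atom)
        (.push_of_eq update_regs_flag))
  generalize hq : (if x = [] then q else .bar :: q) = q' at h₁
  have hq₁ : q'.length ≤ q.length + 1 := by rw [← hq]; split <;> simp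
  have hq₂ : q = [] ∧ x = [] ↔ q' = [] := by rw [← hq]; by_cases hx : x = [] <;> simp [hx]
  have h₂ : Exec (.case .flag fun o =>
      match o with
      | none => .push .workDone (.tag (g s))
      | some _ => .push .workDone (.tag s)) (regs i w w' c c' x x' q' r)
      (regs i w (.tag (if q = [] ∧ x = [] then g s else s) :: w') c c' x x' q'.tail r) 2 := by
    simp only [hq₂]
    rcases q' with _ | ⟨a, q'⟩
    · exact Exec.case_nil rfl (.push_of_eq update_regs_workDone)
    · exact Exec.case_cons rfl update_regs_flag (.push_of_eq update_regs_workDone)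
  refine Exec.mono (.seq h₁ (.seq h₂ (.seq (.congr (exec_clear Reg.flag _) update_regs_flag le_rfl)
    exec_move_atomDone_atom))) ?_
  simp only [regs, List.length_tail]
  omega

/-- The word on `atomDone` and `atom` together stays the same, and any mismatch is recorded on
`flag`. Each bit costs boundedly many steps and lengthens `x'` and `q` by at most one, which the
final cleanup pays for. -/
theorem exec_mark_bits (g : Tag → Tag) (s : Tag) (l : List Bool)
    (h : Exec (.loop .work (markSymbol g)) (regs i w
      (.tag (if q = [] ∧ x = l.map .bit then g s else s) :: ((l.map .bit).reverse ++ w')) c c'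
        (x'.reverse ++ x) [] [] r) S t) :
    Exec (.loop .work (markSymbol g)) (regs i (l.map .bit ++ .tag s :: w) w' c c' x x' q r) S
      (t + (20 * l.length + 2 * x'.length + 2 * q.length + 20)) := by
  induction l generalizing w' x x' q with
  | nil => exact Exec.mono (exec_mark_tag g s h) (by simp)
  | cons b l ih =>
    rcases x with _ | ⟨a, x⟩
    · have h₁ := ih (w' := .bit b :: w') (x := []) (x' := x') (q := .bar :: q) (by simpa using h)
      refine Exec.mono (.loop_step rfl update_regs_work (.seq (.push_of_eq update_regs_workDone)
        (.case_nil rfl (.push_of_eq update_regs_flag))) h₁) ?_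
      simp only [List.length_cons]
      omega
    · by_cases hab : a = .bit b
      · subst hab
        have h₁ := ih (w' := .bit b :: w') (x := x) (x' := .bit b :: x') (q := q)
          (by simpa using h)
        refine Exec.mono (.loop_step rfl update_regs_work (.seq (.push_of_eq update_regs_workDone)
          (.case_cons rfl update_regs_atom (.seq (.push_of_eq update_regs_atomDone) ?_)))
            h₁ (t₁ := 1 + (1 + 1 + 1))) ?_
        · rw [if_pos rfl]
          exact .skip _
        · simp only [List.length_cons]
          omega
      · have h₁ := ih (w' := .bit b :: w') (x := x) (x' := a :: x') (q := .bar :: q)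
          (by simpa [hab] using h)
        refine Exec.mono (.loop_step rfl update_regs_work (.seq (.push_of_eq update_regs_workDone)
          (.case_cons rfl update_regs_atom (.seq (.push_of_eq update_regs_atomDone) ?_)))
            h₁ (t₁ := 1 + (1 + 1 + 1))) ?_
        · rw [if_neg hab]
          exact .push_of_eq update_regs_flag
        · simp only [List.length_cons]
          omega

theorem exec_mark_atoms (g : Tag → Tag) (τ : ℕ → Tag) (a : ℕ) (l : List ℕ)
    (h : Exec (.loop .work (markSymbol g))
      (regs i w ((writeAtoms (mark g τ a) l).reverse ++ w') c c' (writeBits a) [] [] r) S t) :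
    Exec (.loop .work (markSymbol g)) (regs i (writeAtoms τ l ++ w) w' c c' (writeBits a) [] [] r) S
      (t + 20 * (writeAtoms τ l).length) := by
  induction l generalizing w' with
  | nil => exact h
  | cons b l ih =>
    have hb : (if ([] : List WorkSymbol) = [] ∧ writeBits a = (Computability.encodeNat b).map .bit
        then g (τ b) else τ b) = mark g τ a b := by
      by_cases hab : b = a
      · subst hab
        simp [mark, writeBits]
      · rw [if_neg fun h' => hab (writeBits_injective h'.2).symm, mark, update_of_ne hab]
    have h₁ := ih (w' := .tag (mark g τ a b) :: ((writeBits b).reverse ++ w')) (by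
      simpa [writeAtoms_cons] using h)
    -- With `x'` and `q` empty, the cost is 20 per symbol, the tag included.
    have h₂ := exec_mark_bits (w := writeAtoms τ l ++ w) (w' := w') (x := writeBits a) (x' := [])
      (q := []) g (τ b) (Computability.encodeNat b) (by rw [hb]; exact h₁)
    rw [writeAtoms_cons, List.append_assoc, List.cons_append]
    refine Exec.mono h₂ ?_
    simp only [List.length_append, List.length_cons, List.length_nil, writeBits, List.length_map]
    omega

theorem exec_mark_clauses (g : Tag → Tag) (τ : ℕ → Tag) (a : ℕ) (cs : List (List ℕ × List ℕ)) :
    Exec (.loop .work (markSymbol g)) (regs i (writeClauses τ cs) w' c c' (writeBits a) [] [] r)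
      (regs i [] ((writeClauses (mark g τ a) cs).reverse ++ w') c c' (writeBits a) [] [] r)
      (20 * (writeClauses τ cs).length + 1) := by
  induction cs generalizing w' with
  | nil => exact Exec.loop_nil rfl
  | cons p cs ih =>
    have h₁ := ih (w' := (writeClause (mark g τ a) p).reverse ++ w')
    simp only [writeClauses, List.flatMap_cons, writeClause, List.append_assoc, List.cons_append,
      List.nil_append, List.reverse_append, List.reverse_cons, List.reverse_nil, List.length_append,
      List.length_cons] at h₁ ⊢
    refine Exec.mono (exec_mark_atoms g τ a p.1 (.loop_step rfl update_regs_work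
      (.push_of_eq update_regs_workDone) (exec_mark_atoms g τ a p.2 (.loop_step rfl
        update_regs_work (.push_of_eq update_regs_workDone) h₁)))) ?_
    omega

theorem exec_markProg (g : Tag → Tag) (τ : ℕ → Tag) (a : ℕ) (cs : List (List ℕ × List ℕ)) :
    Exec (markProg g) (regs i (writeClauses τ cs) [] c c' (writeBits a) [] [] r)
      (regs i (writeClauses (mark g τ a) cs) [] c c' (writeBits a) [] [] r)
      (22 * (writeClauses τ cs).length + 2) := by
  refine Exec.congr (.seq (exec_mark_clauses g τ a cs) exec_move_workDone_work) (by simp) ?_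
  rw [List.append_nil, List.length_reverse, length_writeClauses (mark g τ a) τ]
  omega

end Marking

/-! ### Running automata, and examining one atom. -/

section Scanning

/-- Process one symbol of the written clauses: let the automaton, whose state is on the stack
`flag`, make a step. -/
def scanSymbol (δ : ScanState → WorkSymbol → ScanState) (a : WorkSymbol) : Prog :=
  .seq (.push .workDone a) (.case .flag fun o =>
    match o with
    | some (.state q) => .push .flag (.state (δ q a))
    | _ => .skip)

/-- Run a scanning automaton on the written clauses. -/
def scanProg (δ : ScanState → WorkSymbol → ScanState) : Prog :=
  .seq (.push .flag (.state .head)) (.seq (.loop .work (scanSymbol δ)) (move .workDone .work))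

variable {i w w' c c' x x' r : List WorkSymbol}

theorem exec_scan_loop (δ : ScanState → WorkSymbol → ScanState) (q : ScanState) :
    Exec (.loop .work (scanSymbol δ)) (regs i w w' c c' x x' [.state q] r)
      (regs i [] (w.reverse ++ w') c c' x x' [.state (w.foldl δ q)] r) (4 * w.length + 1) := by
  induction w generalizing w' q with
  | nil => exact Exec.loop_nil rfl
  | cons a w ih =>
    refine Exec.congr (.loop_step rfl update_regs_work (.seq (.push_of_eq update_regs_workDone)
      (.case_cons rfl update_regs_flag (.push_of_eq update_regs_flag)))
        (ih (w' := a :: w') (δ q a))) (by simp) ?_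
    rw [List.length_cons]
    omega

theorem exec_scanProg (δ : ScanState → WorkSymbol → ScanState) :
    Exec (scanProg δ) (regs i w [] c c' x x' [] r)
      (regs i w [] c c' x x' [.state (w.foldl δ .head)] r) (6 * w.length + 3) := by
  refine Exec.congr (.seq (.push_of_eq update_regs_flag) (.seq (exec_scan_loop δ .head)
    exec_move_workDone_work)) (by simp) ?_
  rw [List.append_nil, List.length_reverse]
  omega

/-- Test whether the current atom can be derived, and tag it accordingly. -/
def examineProg : Prog :=
  .seq (markProg .toCur) (.seq (scanProg searchStep) (.case .flag fun o =>
    if o = some (.state .done) then markProg (Tag.ofCur .der) else markProg (Tag.ofCur .rem)))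

/-- Two markings at 22 and a scan at 6 per symbol. Reading the final state pops it, so `flag` is
empty again for the second marking. -/
theorem exec_examineProg (τ : ℕ → Tag) (a : ℕ) (cs : List (List ℕ × List ℕ)) :
    Exec examineProg (regs i (writeClauses τ cs) [] c c' (writeBits a) [] [] r)
      (regs i (writeClauses (examine cs τ a) cs) [] c c' (writeBits a) [] [] r)
      (50 * (writeClauses τ cs).length + 8) := by
  refine Exec.mono (.seq (exec_markProg .toCur τ a cs) (.seq (exec_scanProg searchStep)
    (.case_cons rfl update_regs_flag
      (t := 22 * (writeClauses τ cs).length + 2) ?_))) ?_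
  · rw [length_writeClauses τ (mark .toCur τ a)]
    unfold examine
    by_cases h : (writeClauses (mark .toCur τ a) cs).foldl searchStep .head = .done
    · rw [if_pos h, if_pos (by rw [h])]
      exact exec_markProg _ _ a cs
    · rw [if_neg h, if_neg (by simpa using h)]
      exact exec_markProg _ _ a cs
  · rw [length_writeClauses (mark .toCur τ a) τ]
    omega

end Scanning

/-! ### Loops over the candidate atoms, and rounds. -/

section Iteration

/-- Process one symbol of the candidate list: collect bits, and at the end of an atom run `p`. -/
def candSymbol (p : Prog) : WorkSymbol → Prog
  | .tag t => .seq (.push .candDone (.tag t)) (.seq (move .atomDone .atom) (.seq p (clear .atom)))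
  | a => .seq (.push .candDone a) (.push .atomDone a)

/-- Run `p` for each atom of the candidate list. -/
def forCand (p : Prog) : Prog :=
  .seq (.loop .cand (candSymbol p)) (move .candDone .cand)

variable {i w w' c c' x x' q r : List WorkSymbol} {S : Reg → List WorkSymbol} {t : ℕ}

theorem exec_cand_bits (p : Prog) (l : List Bool)
    (h : Exec (.loop .cand (candSymbol p))
      (regs i w w' c ((l.map .bit).reverse ++ c') x ((l.map .bit).reverse ++ x') q r) S t) :
    Exec (.loop .cand (candSymbol p)) (regs i w w' (l.map .bit ++ c) c' x x' q r) S
      (t + 3 * l.length) := by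
  induction l generalizing c' x' with
  | nil => exact h
  | cons b l ih =>
    have h₁ := ih (c' := .bit b :: c') (x' := .bit b :: x') (by simpa using h)
    refine Exec.mono (.loop_step rfl update_regs_cand (.seq (.push_of_eq update_regs_candDone)
      (.push_of_eq update_regs_atomDone)) h₁) ?_
    rw [List.length_cons]
    omega

/-- `hp` is required for arbitrary `c` and `c'` because the candidate list is split between `cand`
and `candDone` while `p` runs. Each atom has at least its tag symbol, so charging `B` per symbol
covers one run of `p` per atom. -/
theorem exec_forCand {p : Prog} {cs : List (List ℕ × List ℕ)} {F : (ℕ → Tag) → ℕ → ℕ → Tag} {B : ℕ}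
    (hp : ∀ τ a c c', Exec p (regs i (writeClauses τ cs) [] c c' (writeBits a) [] [] r)
      (regs i (writeClauses (F τ a) cs) [] c c' (writeBits a) [] [] r) B)
    (τ : ℕ → Tag) (σ : ℕ → Tag) (l : List ℕ) :
    Exec (forCand p) (regs i (writeClauses τ cs) [] (writeAtoms σ l) [] [] [] [] r)
      (regs i (writeClauses (l.foldl F τ) cs) [] (writeAtoms σ l) [] [] [] [] r)
      ((B + 12) * (writeAtoms σ l).length + 2) := by
  have key : ∀ (τ : ℕ → Tag) (c' : List WorkSymbol), Exec (.loop .cand (candSymbol p))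
      (regs i (writeClauses τ cs) [] (writeAtoms σ l) c' [] [] [] r)
      (regs i (writeClauses (l.foldl F τ) cs) [] [] ((writeAtoms σ l).reverse ++ c') [] [] [] r)
      ((B + 10) * (writeAtoms σ l).length + 1) := by
    induction l with
    | nil => exact fun _ _ => (Exec.loop_nil rfl).mono (by omega)
    | cons a l ih =>
      intro τ c'
      have h₁ : Exec (.loop .cand (candSymbol p)) (regs i (writeClauses τ cs) []
          (.tag (σ a) :: writeAtoms σ l) ((writeBits a).reverse ++ c') []
          ((writeBits a).reverse ++ []) [] r)
          (regs i (writeClauses ((a :: l).foldl F τ) cs) [] []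
            ((writeAtoms σ l).reverse ++ .tag (σ a) :: ((writeBits a).reverse ++ c')) [] [] [] r)
          ((B + 10) * (writeAtoms σ l).length + 1 + (4 * (writeBits a).length + B + 5)) := by
        refine Exec.mono (.loop_step rfl update_regs_cand (.seq (.push_of_eq update_regs_candDone)
          (.seq exec_move_atomDone_atom (.seq (t₁ := B) ?_
            (.congr (exec_clear Reg.atom _)
              (update_regs_atom (x := writeBits a)) le_rfl)))) (ih (F τ a) _)) ?_
        · have h := hp τ a (writeAtoms σ l) (.tag (σ a) :: ((writeBits a).reverse ++ c'))
          simpa [show ∀ i w w' c c' x x' q r, regs i w w' c c' x x' q r .candDone = c' from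
            fun _ _ _ _ _ _ _ _ _ => rfl] using h
        · simp only [regs, List.append_nil, List.length_reverse]
          omega
      have h₂ := exec_cand_bits (c := .tag (σ a) :: writeAtoms σ l) (c' := c') (x' := []) p
        (Computability.encodeNat a) h₁
      rw [writeAtoms_cons]
      refine Exec.congr h₂ (by simp) ?_
      simp only [List.length_append, List.length_cons, writeBits, List.length_map]
      nlinarith
  refine Exec.congr (.seq (key τ []) exec_move_candDone_cand) (by simp) ?_
  rw [List.append_nil, List.length_reverse]
  nlinarith

/-- As many rounds of examination as there are symbols on the stack `count`. -/
def roundsProg : Prog := .loop .count fun _ => forCand examineProg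

theorem exec_roundsProg (τ σ : ℕ → Tag) (cs : List (List ℕ × List ℕ)) (l : List ℕ) :
    Exec roundsProg (regs i (writeClauses τ cs) [] (writeAtoms σ l) [] [] [] [] r)
      (regs i (writeClauses ((fun τ => l.foldl (examine cs) τ)^[r.length] τ) cs) []
        (writeAtoms σ l) [] [] [] [] [])
      (r.length * ((50 * (writeClauses τ cs).length + 20) * (writeAtoms σ l).length + 3) + 1) := by
  induction r generalizing τ with
  | nil => exact (Exec.loop_nil rfl).mono (by omega)
  | cons a r ih =>
    have h₁ := exec_forCand (i := i) (r := r) (p := examineProg) (cs := cs) (F := examine cs)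
      (B := 50 * (writeClauses τ cs).length + 8) (fun τ' a c c' => by
        rw [length_writeClauses τ τ']
        exact exec_examineProg τ' a cs) τ σ l
    refine Exec.mono (.loop_step rfl update_regs_count h₁ (ih _)) ?_
    rw [length_writeClauses _ τ, List.length_cons]
    linarith

end Iteration

/-! ### Distributing the input, and the whole program. -/

section Loading

/-- Distribute the input: the candidate list goes to `cand` and to `count`, the clauses go to
`work`. -/
def loadProg : Prog :=
  .loop .input fun a =>
    if a = .bar then move .input .work else .seq (.push .cand a) (.push .count a)

variable {i w w' c c' x x' q r : List WorkSymbol}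

/-- At the separator, `move` empties the input stack from inside the loop, which therefore ends at
its next test; `hl` ensures that the separator is the first bar. The copy of `l` on `count` serves
as a unary counter. -/
theorem exec_loadProg (l : List WorkSymbol) (hl : .bar ∉ l) :
    Exec loadProg (regs (l ++ .bar :: i) w w' c c' x x' q r)
      (regs [] (i.reverse ++ w) w' (l.reverse ++ c) c' x x' q (l.reverse ++ r))
      (3 * l.length + 2 * i.length + 3) := by
  induction l generalizing c r with
  | nil =>
    refine Exec.mono (.loop_step rfl update_regs_input (t₁ := 2 * i.length + 1) ?_
      (.loop_nil rfl)) (by simp; omega)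
    rw [if_pos rfl]
    exact (exec_move (by decide) _).congr
      ((congrArg (fun S => update S _ _) update_regs_input).trans update_regs_work) le_rfl
  | cons a l ih =>
    rw [List.mem_cons, not_or] at hl
    refine Exec.congr (.loop_step rfl update_regs_input (t₁ := 2) ?_
      (ih (c := a :: c) (r := a :: r) hl.2)) (by simp) (by rw [List.length_cons]; omega)
    rw [if_neg (Ne.symm hl.1)]
    exact .seq (.push_of_eq update_regs_cand) (.push_of_eq update_regs_count)

theorem bar_notMem_writeAtoms (τ : ℕ → Tag) (l : List ℕ) : .bar ∉ writeAtoms τ l := by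
  simp [writeAtoms, writeAtom, writeBits]

end Loading

/-- The minimal model checking program. -/
def checkProg : Prog :=
  .seq loadProg (.seq (forCand (markProg fun _ => .rem)) (.seq roundsProg
    (.seq (scanProg checkStep) (.seq (.case .flag fun o =>
      if o = some (.state .bad) then .skip else .push .flag .bar)
    (.seq (clear .work) (clear .cand))))))

/-- A bound for the running time of the minimal model checking program. -/
noncomputable def timeBound : Polynomial ℕ := 200 * (Polynomial.X + 1) ^ 3

theorem timeBound_eval (n : ℕ) : timeBound.eval n = 200 * (n + 1) ^ 3 := by
  simp [timeBound]

theorem exec_checkProg (I : Input) :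
    Exec checkProg (regs (I.encode.map Symbol.toWork).reverse [] [] [] [] [] [] [] [])
      (regs [] [] [] [] [] [] [] (if answer I then [.bar] else []) [])
      (timeBound.eval I.encode.length) := by
  let out : ℕ → Tag := fun _ => .out
  let A := writeAtoms out I.candidate
  let W := writeClauses out I.clauses
  have hlen : I.encode.length = W.length + A.length + 1 := by
    rw [← List.length_map Symbol.toWork, map_toWork_encode]
    simp only [List.length_append, List.length_cons, A, W, out]
    omega
  -- The machine delivers the input reversed, candidate list on top; pushing restores the order.
  have h₁ : Exec loadProg (regs (A.reverse ++ .bar :: W.reverse) [] [] [] [] [] [] [] [])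
      (regs [] W [] A [] [] [] [] A) (3 * A.length + 2 * W.length + 3) :=
    (exec_loadProg A.reverse (by simpa using bar_notMem_writeAtoms _ _)).congr (by simp)
      (by simp)
  have h₂ := exec_forCand (i := []) (r := A) (p := markProg fun _ => .rem) (cs := I.clauses)
    (F := mark fun _ => .rem) (B := 22 * W.length + 2) (fun τ a c c' => by
      rw [show W.length = _ from length_writeClauses out τ I.clauses]
      exact exec_markProg _ τ a _) out out I.candidate
  -- With `A` on `count` there are `A.length` rounds, which is `rounds I` by definition, so the tags
  -- become `finalTags I (rounds I)`.
  have h₃ := exec_roundsProg (i := []) (r := A) (I.candidate.foldl (mark fun _ => .rem) out) out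
    I.clauses I.candidate
  have h₄ := exec_scanProg (i := []) (w := writeClauses (finalTags I (rounds I)) I.clauses)
    (c := A) (c' := []) (x := []) (x' := []) (r := []) checkStep
  have h₅ : Exec (.case .flag fun o =>
      if o = some (.state .bad) then .skip else .push .flag .bar)
      (regs [] (writeClauses (finalTags I (rounds I)) I.clauses) [] A [] [] []
        [.state ((writeClauses (finalTags I (rounds I)) I.clauses).foldl checkStep .head)] [])
      (regs [] (writeClauses (finalTags I (rounds I)) I.clauses) [] A [] [] []
        (if answer I then [.bar] else []) []) 2 := by
    refine Exec.case_cons rfl update_regs_flag ?_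
    by_cases h : (writeClauses (finalTags I (rounds I)) I.clauses).foldl checkStep .head = .bad
    · rw [if_pos (by rw [h]), show answer I = false by simp [answer, h]]
      exact .skip _
    · rw [if_neg (by simpa using h), show answer I = true by simp [answer, h]]
      exact .push_of_eq update_regs_flag
  have h₆ := (exec_clear Reg.work (regs [] (writeClauses (finalTags I (rounds I)) I.clauses) [] A []
    [] [] (if answer I then [.bar] else []) [])).congr update_regs_work le_rfl
  have h₇ := (exec_clear Reg.cand (regs [] [] [] A []
    [] [] (if answer I then [.bar] else []) [])).congr update_regs_cand le_rfl
  have hW : ∀ τ, (writeClauses τ I.clauses).length = W.length := fun τ =>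
    length_writeClauses τ out I.clauses
  rw [map_toWork_encode, List.reverse_append, List.reverse_cons, List.append_assoc,
    List.singleton_append]
  refine Exec.mono (.seq h₁ (.seq h₂ (.seq h₃ (.seq h₄ (.seq h₅ (.seq h₆ h₇)))))) ?_
  rw [timeBound_eval, hlen]
  simp only [regs, hW]
  -- The dominant term is `50 * n * m ^ 2`, for `m` candidate and `n` clause symbols: `m` rounds, at
  -- most `m` atoms in each, and passes linear in `n` for each atom.
  change _ + ((22 * W.length + 2 + 12) * A.length + 2 +
    (A.length * ((50 * W.length + 20) * A.length + 3) + 1 + _)) ≤ _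
  generalize A.length = m
  generalize W.length = n
  ring_nf
  nlinarith [Nat.zero_le (m ^ 2 * n), Nat.zero_le (m * n ^ 2), Nat.zero_le (m ^ 3),
    Nat.zero_le (n ^ 3), Nat.zero_le (m * n), Nat.zero_le (m ^ 2), Nat.zero_le (n ^ 2)]

end CNF

/-- Some Boolean function on inputs is computed by a Turing machine in time polynomial in the length
of the input string, and it answers correctly whether the candidate set is a minimal model
whenever the theory is positive and HEF and the candidate set consists of atoms of the theory. -/
theorem mainTheorem3 :
    ∃ f : CNF.Input → Bool,
      Nonempty (Turing.TM2ComputableInPolyTime CNF.Input.encode Computability.encodeBool f) ∧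
      ∀ I : CNF.Input, CNF.IsPositive I.theory → CNF.IsHEF I.theory →
        I.set ⊆ CNF.atoms I.theory →
        (f I = true ↔ CNF.IsMinimalModel I.theory I.set) := by
  refine ⟨CNF.answer, ?_, fun I _ hI hN => CNF.answer_eq_true_iff hI hN⟩
  have hempty : (fun _ => []) = CNF.regs [] [] [] [] [] [] [] [] [] := by
    funext k
    cases k <;> rfl
  refine StackProg.tm2ComputableInPolyTime CNF.Input.encode CNF.answer CNF.Symbol.toWork .input .flag
    CNF.checkProg CNF.timeBound fun I =>
      ⟨if CNF.answer I then [.bar] else [], by cases CNF.answer I <;> simp,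
        by cases CNF.answer I <;> simp, ?_⟩
  rw [hempty, CNF.update_regs_input, CNF.update_regs_flag]
  exact CNF.exec_checkProg I
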